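/- Let $X$ be a topological space and let $CL(X)$ be the set of all nonempty closed subsets of $X$. For an open set $U\subseteq X$ and a locally finite family $\mathcal V$ of open subsets of $X$ put $$U^+=\{A\in CL(X): A\subseteq U\},\qquad \mathcal V^-=\{A\in CL(X): A\cap V\neq\emptyset\ \text{for every } V\in\mathcal V\}.$$ The locally finite topology $\tau_{lf}$ on $CL(X)$ is the topology that has all sets $U^+$ and all sets $\mathcal V^-$ of this kind as a subbase; its basic sets are the sets $U^+\cap\mathcal V^-$. The space $(CL(X),\tau_{lf})$ has an $\omega^\omega$-base consisting of basic neighbourhoods if every $A\in CL(X)$ has a neighbourhood base $\{\mathbf U_\alpha:\alpha\in\omega^\omega\}$ in $\tau_{lf}$ such that each $\mathbf U_\alpha$ is a basic set and $\mathbf U_\beta\subseteq\mathbf U_\alpha$ whenever $\alpha\le\beta$, where $\alpha\le\beta$ means $\alpha(n)\le\beta(n)$ for all $n\in\omega$. **Theorem.** Let $X$ be a metrizable space. If $(CL(X),\tau_{lf})$ has an $\omega^\omega$-base consisting of basic neighbourhoods, then the boundary of every closed subset of $X$ is $\sigma$-compact (a countable union of compact sets). -/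

import Mathlib

open Set Topology

/-- The hyperspace `CL(X)` of nonempty closed subsets of `X`, as a bare type without a topology. -/
def CL (X : Type*) [TopologicalSpace X] : Type _ :=
  {A : Set X // A.Nonempty ∧ IsClosed A}

/-- `U⁺`: the nonempty closed sets contained in `U`. -/
def CL.upper {X : Type*} [TopologicalSpace X] (U : Set X) : Set (CL X) :=
  {A | A.1 ⊆ U}

/-- `𝒱⁻`: the nonempty closed sets that meet every member of the family `𝒱`. -/
def CL.lower {X : Type*} [TopologicalSpace X] (𝒱 : Set (Set X)) : Set (CL X) :=
  {A | ∀ V ∈ 𝒱, (A.1 ∩ V).Nonempty}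

/-- `𝒱` is a locally finite family of open sets: every point of `X` has a neighbourhood that meets
only finitely many members of `𝒱`. -/
def IsLocallyFiniteOpenFamily {X : Type*} [TopologicalSpace X] (𝒱 : Set (Set X)) : Prop :=
  (∀ V ∈ 𝒱, IsOpen V) ∧ LocallyFinite (fun V : 𝒱 => (V : Set X))

/-- The locally finite topology on `CL(X)`, generated by the subbase of all sets `U⁺` with `U` open
and all sets `𝒱⁻` with `𝒱` a locally finite family of open sets. -/
def locallyFiniteTopology (X : Type*) [TopologicalSpace X] : TopologicalSpace (CL X) :=
  TopologicalSpace.generateFrom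
    ({S | ∃ U : Set X, IsOpen U ∧ S = CL.upper U} ∪
      {S | ∃ 𝒱 : Set (Set X), IsLocallyFiniteOpenFamily 𝒱 ∧ S = CL.lower 𝒱})

/-- The basic sets of the locally finite topology, `U⁺ ∩ 𝒱⁻` with `U` open and `𝒱` a locally finite
family of open sets. They are exactly the finite intersections of the subbasic sets, since
`U⁺ ∩ W⁺ = (U ∩ W)⁺`, `𝒱⁻ ∩ 𝒲⁻ = (𝒱 ∪ 𝒲)⁻`, and a union of two locally finite families is locally
finite. -/
def IsLocallyFiniteBasic {X : Type*} [TopologicalSpace X] (S : Set (CL X)) : Prop :=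
  ∃ (U : Set X) (𝒱 : Set (Set X)),
    IsOpen U ∧ IsLocallyFiniteOpenFamily 𝒱 ∧ S = CL.upper U ∩ CL.lower 𝒱

/-- The topology `t` on `Y` has an `ω^ω`-base all of whose members satisfy `P`: every point `y` has
a neighbourhood base `(B α)` indexed by `α : ℕ → ℕ`, with `B β ⊆ B α` whenever `α ≤ β` pointwise,
and with `P (B α)` for all `α`. -/
def HasOmegaOmegaBaseOf {Y : Type*} (t : TopologicalSpace Y) (P : Set Y → Prop) : Prop :=
  ∀ y : Y, ∃ B : (ℕ → ℕ) → Set Y,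
    (@nhds Y t y).HasBasis (fun _ => True) B ∧
    (∀ α β : ℕ → ℕ, α ≤ β → B β ⊆ B α) ∧
    (∀ α, P (B α))

/-! A basic neighbourhood `U⁺ ∩ 𝒱⁻` of `A` contains `A ∪ {x}` for every `x ∈ U`, so the open parts
`U α` form an antitone neighbourhood base of the set `A` in `X`. The frontier is then second
countable: finite prefixes give countably many open sets that localise this base at points of `A`,
whereas an uncountable separated subset of the frontier could be pushed off `A` to a closed set that
defeats them (`secondCountableTopology_frontier`). Hence the frontier embeds in the Hilbert cube,
and its image inherits an antitone neighbourhood base. In a compact metric space a set with such a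
base is the union of its interior and the complements of countably many open sets, the levels of a
tree (`isSigmaCompact_of_antitone_nhdsSet_basis`). -/

/-- `IsPrefixBound s β`: the list `s`, read from its last entry to its first, bounds the first
`s.length` values of `β`. -/
def IsPrefixBound : List ℕ → (ℕ → ℕ) → Prop
  | [], _ => True
  | i :: s, β => β s.length ≤ i ∧ IsPrefixBound s β

/-- The first `k` values of `α`, in reverse order. -/
def revPrefix (α : ℕ → ℕ) : ℕ → List ℕ
  | 0 => []
  | k + 1 => α k :: revPrefix α k

@[simp] theorem length_revPrefix (α : ℕ → ℕ) (k : ℕ) : (revPrefix α k).length = k := by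
  induction k with
  | zero => rfl
  | succ k ih => simp [revPrefix, ih]

theorem isPrefixBound_revPrefix {α β : ℕ → ℕ} {k : ℕ} :
    IsPrefixBound (revPrefix α k) β ↔ ∀ j < k, β j ≤ α j := by
  induction k with
  | zero => simp [revPrefix, IsPrefixBound]
  | succ k ih =>
    rw [Nat.forall_lt_succ_right, and_comm, ← ih]
    simp [revPrefix, IsPrefixBound]

/-- For an antitone family of neighbourhoods of a point with a countable neighbourhood base, each
index has a finite initial segment such that all members of the family whose indices are bounded
by that segment contain a common neighbourhood. -/
theorem exists_nhds_subset_of_isPrefixBound {X : Type*} [TopologicalSpace X]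
    [FirstCountableTopology X] {U : (ℕ → ℕ) → Set X} (hU : Antitone U) {x : X}
    (hx : ∀ α, U α ∈ 𝓝 x) (α : ℕ → ℕ) :
    ∃ k, ∃ N ∈ 𝓝 x, ∀ β, IsPrefixBound (revPrefix α k) β → N ⊆ U β := by
  obtain ⟨b, hb⟩ := (𝓝 x).exists_antitone_basis
  by_contra! h
  choose β hβ hN using fun k => h k (b k) (hb.mem k)
  -- `γ` dominates every `β k`: below `k` the term `α j` suffices, and from `k` on `β k j` is a
  -- summand.
  let γ : ℕ → ℕ := fun j => α j + ∑ k ∈ Finset.range (j + 1), β k j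
  obtain ⟨k, hk⟩ := hb.mem_iff.1 (hx γ)
  refine hN k (hk.trans (hU fun j => ?_))
  rcases lt_or_ge j k with hj | hj
  · exact (isPrefixBound_revPrefix.1 (hβ k) j hj).trans (Nat.le_add_right _ _)
  · exact (Finset.single_le_sum (f := fun k => β k j) (fun _ _ => Nat.zero_le _)
      (Finset.mem_range.2 (by omega))).trans (Nat.le_add_left _ _)

/-! ### Christensen's theorem in compact metric spaces -/

section Christensen

variable {Z : Type*}

/-- The union of all open sets `V` such that every closed subset of `V \ F` misses a member of the
family `O` whose index is bounded by `s`. -/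
def goodSet [TopologicalSpace Z] (F : Set Z) (O : (ℕ → ℕ) → Set Z) (s : List ℕ) : Set Z :=
  ⋃₀ {V | IsOpen V ∧ ∀ C, IsClosed C → C ⊆ V \ F → ∃ β, IsPrefixBound s β ∧ Disjoint C (O β)}

theorem isOpen_goodSet [TopologicalSpace Z] (F : Set Z) (O : (ℕ → ℕ) → Set Z) (s : List ℕ) :
    IsOpen (goodSet F O s) :=
  isOpen_sUnion fun _ hV => hV.1

theorem goodSet_mono [TopologicalSpace Z] {F : Set Z} {O : (ℕ → ℕ) → Set Z} {s t : List ℕ}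
    (h : ∀ β, IsPrefixBound s β → IsPrefixBound t β) : goodSet F O s ⊆ goodSet F O t := by
  refine sUnion_subset_sUnion fun V hV => ⟨hV.1, fun C hC hCV => ?_⟩
  obtain ⟨β, hβ, hd⟩ := hV.2 C hC hCV
  exact ⟨β, h β hβ, hd⟩

theorem goodSet_nil [TopologicalSpace Z] {F : Set Z} {O : (ℕ → ℕ) → Set Z}
    (hO : ∀ V, IsOpen V → F ⊆ V → ∃ α, O α ⊆ V) : goodSet F O [] = univ := by
  refine eq_univ_of_forall fun z => ⟨univ, ⟨isOpen_univ, fun C hC hCV => ?_⟩, mem_univ z⟩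
  obtain ⟨α, hα⟩ := hO Cᶜ hC.isOpen_compl fun x hx hxC => (hCV hxC).2 hx
  exact ⟨α, trivial, (disjoint_compl_right.mono_right hα)⟩

theorem isClosed_insert_iUnion [MetricSpace Z] {y : Z} {C : ℕ → Set Z}
    (hC : ∀ i, IsClosed (C i)) (hy : ∀ i, C i ⊆ Metric.ball y (1 / (i + 1 : ℝ))) :
    IsClosed (insert y (⋃ i, C i)) := by
  refine isClosed_of_closure_subset fun z hz => ?_
  by_contra hzC
  have hzy : 0 < dist z y := dist_pos.2 fun h => hzC (h ▸ mem_insert _ _)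
  obtain ⟨n, hn⟩ := exists_nat_one_div_lt (half_pos hzy)
  have hsub : insert y (⋃ i, C i) ⊆ Metric.closedBall y (dist z y / 2) ∪ ⋃ i ∈ Iio n, C i := by
    refine insert_subset (Or.inl (Metric.mem_closedBall_self (by positivity)))
      (iUnion_subset fun i w hw => ?_)
    rcases lt_or_ge i n with hi | hi
    · exact Or.inr (mem_biUnion hi hw)
    · refine Or.inl ((Metric.mem_ball.1 (hy i hw)).le.trans (le_trans ?_ hn.le))
      gcongr
  have hcl : IsClosed (Metric.closedBall y (dist z y / 2) ∪ ⋃ i ∈ Iio n, C i) :=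
    Metric.isClosed_closedBall.union ((finite_Iio n).isClosed_biUnion fun i _ => hC i)
  rcases closure_minimal hsub hcl hz with h | h
  · have := Metric.mem_closedBall.1 h
    linarith
  · obtain ⟨i, -, hi⟩ := mem_iUnion₂.1 h
    exact hzC (Or.inr (mem_iUnion.2 ⟨i, hi⟩))

/-- Otherwise each `i` has a bad closed set `C i` within `1 / (i + 1)` of `y`. Together with `y`
they form a closed set, which misses some `O β`; then `C i` with `i = β s.length` is not bad. -/
theorem exists_mem_goodSet_cons [MetricSpace Z] {F : Set Z} {O : (ℕ → ℕ) → Set Z} {s : List ℕ}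
    {y : Z} (hy : y ∈ goodSet F O s) (hyF : y ∉ F) : ∃ i, y ∈ goodSet F O (i :: s) := by
  obtain ⟨V, ⟨hV, hgood⟩, hyV⟩ := hy
  by_contra! h
  have key : ∀ i : ℕ, ∃ C, IsClosed C ∧ C ⊆ (V ∩ Metric.ball y (1 / (i + 1 : ℝ))) \ F ∧
      ∀ β, IsPrefixBound (i :: s) β → ¬ Disjoint C (O β) := by
    intro i
    by_contra! hi
    exact h i ⟨_, ⟨hV.inter Metric.isOpen_ball, hi⟩, hyV,
      Metric.mem_ball_self (by positivity)⟩
  choose C hC hCV hCO using key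
  obtain ⟨β, hβ, hd⟩ := hgood (insert y (⋃ i, C i))
    (isClosed_insert_iUnion hC fun i z hz => (hCV i hz).1.2)
    (insert_subset ⟨hyV, hyF⟩ (iUnion_subset fun i z hz => ⟨(hCV i hz).1.1, (hCV i hz).2⟩))
  exact hCO (β s.length) β ⟨le_rfl, hβ⟩
    (hd.mono_left ((subset_iUnion C _).trans (subset_insert _ _)))

/-- Near a point of `F`, all `O β` with `β` bounded by a long prefix of `α` share a neighbourhood,
so no singleton close by can miss one of them. -/
theorem notMem_of_forall_mem_goodSet [TopologicalSpace Z] [FirstCountableTopology Z]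
    [T1Space Z] {F : Set Z} {O : (ℕ → ℕ) → Set Z} (hanti : Antitone O) (hopen : ∀ α, IsOpen (O α))
    (hF : ∀ α, F ⊆ O α) {z : Z} {α : ℕ → ℕ} (hz : ∀ k, z ∈ goodSet F O (revPrefix α k))
    (hzcl : z ∈ closure Fᶜ) : z ∉ F := by
  intro hzF
  obtain ⟨k, N, hN, hNO⟩ := exists_nhds_subset_of_isPrefixBound hanti
    (fun α => (hopen α).mem_nhds (hF α hzF)) α
  obtain ⟨V, ⟨hV, hgood⟩, hzV⟩ := hz k
  obtain ⟨y, ⟨hyN, hyV⟩, hyF⟩ :=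
    mem_closure_iff_nhds.1 hzcl _ (Filter.inter_mem hN (hV.mem_nhds hzV))
  obtain ⟨β, hβ, hd⟩ := hgood {y} isClosed_singleton (singleton_subset_iff.2 ⟨hyV, hyF⟩)
  exact disjoint_singleton_left.1 hd (hNO β hβ hyN)

/-- For a tree of open sets `G s` exhausted by the sets `C s n`, the refined tree obtained by
shrinking the children of every node to a point-finite family with the same union. -/
def shrunkTree (G : List ℕ → Set Z) (C : List ℕ → ℕ → Set Z) : List ℕ → Set Z
  | [] => univ
  | i :: s => shrunkTree G C s ∩ (G (i :: s) \ ⋃ j ∈ Iio i, C (j :: s) i)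

section shrunkTree

variable {G : List ℕ → Set Z} {C : List ℕ → ℕ → Set Z}

theorem shrunkTree_subset (hG : G [] = univ) (s : List ℕ) : shrunkTree G C s ⊆ G s := by
  cases s with
  | nil => simp [hG]
  | cons i s => exact fun z hz => hz.2.1

theorem isOpen_shrunkTree [TopologicalSpace Z] (hG : ∀ s, IsOpen (G s))
    (hC : ∀ s n, IsClosed (C s n)) (s : List ℕ) : IsOpen (shrunkTree G C s) := by
  induction s with
  | nil => exact isOpen_univ
  | cons i s ih =>
    exact ih.inter ((hG _).sdiff ((finite_Iio i).isClosed_biUnion fun j _ => hC _ _))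

theorem exists_mem_shrunkTree_cons (hC : ∀ s n, C s n ⊆ G s) {s : List ℕ} {z : Z}
    (hz : z ∈ shrunkTree G C s) (h : ∃ i, z ∈ G (i :: s)) : ∃ i, z ∈ shrunkTree G C (i :: s) := by
  classical
  -- At the least index nothing containing `z` has been removed.
  refine ⟨Nat.find h, hz, Nat.find_spec h, fun hmem => ?_⟩
  obtain ⟨j, hj, hjC⟩ := mem_iUnion₂.1 hmem
  exact Nat.find_min h hj (hC _ _ hjC)

theorem finite_setOf_mem_shrunkTree_cons (hCG : ∀ s, ⋃ n, C s n = G s)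
    (hmono : ∀ s, Monotone (C s)) (s : List ℕ) (z : Z) :
    {i | z ∈ shrunkTree G C (i :: s)}.Finite := by
  rcases eq_empty_or_nonempty {i | z ∈ shrunkTree G C (i :: s)} with he | ⟨j, hj⟩
  · simp [he]
  obtain ⟨n, hn⟩ := mem_iUnion.1 ((hCG (j :: s)).symm ▸ hj.2.1 : z ∈ ⋃ n, C (j :: s) n)
  refine (finite_Iic (max j n)).subset fun i hi => ?_
  by_contra hlt
  obtain ⟨hji, hni⟩ := max_lt_iff.1 (not_le.1 fun h => hlt (mem_Iic.2 h))
  exact hi.2.2 (mem_biUnion hji (hmono _ hni.le hn))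

theorem finite_setOf_length_eq_mem_shrunkTree (hCG : ∀ s, ⋃ n, C s n = G s)
    (hmono : ∀ s, Monotone (C s)) (k : ℕ) (z : Z) :
    {s : List ℕ | s.length = k ∧ z ∈ shrunkTree G C s}.Finite := by
  induction k with
  | zero => exact (finite_singleton []).subset fun s hs => List.length_eq_zero_iff.1 hs.1
  | succ k ih =>
    refine (ih.biUnion fun s _ => (finite_setOf_mem_shrunkTree_cons hCG hmono s z).image
      (fun i => i :: s)).subset ?_
    rintro (_ | ⟨i, s⟩) ⟨hl, hz⟩
    · simp at hl
    · exact mem_biUnion (show s ∈ {s : List ℕ | s.length = k ∧ z ∈ shrunkTree G C s} from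
        ⟨by simpa using hl, hz.1⟩) ⟨i, hz, rfl⟩

/-- All nodes of the shrunk tree that contain a given point are bounded by one sequence. -/
theorem exists_bound_of_mem_shrunkTree (hCG : ∀ s, ⋃ n, C s n = G s)
    (hmono : ∀ s, Monotone (C s)) (z : Z) :
    ∃ α : ℕ → ℕ, ∀ s, z ∈ shrunkTree G C s →
      ∀ β, IsPrefixBound s β → IsPrefixBound (revPrefix α s.length) β := by
  have hbdd : ∀ k, ∃ N, ∀ s i, s.length = k → z ∈ shrunkTree G C (i :: s) → i ≤ N := by
    intro k
    obtain ⟨N, hN⟩ := ((finite_setOf_length_eq_mem_shrunkTree hCG hmono (k + 1) z).image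
      List.headI).bddAbove
    exact ⟨N, fun s i hs hz => hN ⟨i :: s, ⟨by simp [hs], hz⟩, rfl⟩⟩
  choose α hα using hbdd
  refine ⟨α, fun s => ?_⟩
  induction s with
  | nil => exact fun _ _ _ => trivial
  | cons i s ih =>
    exact fun hz β hβ => ⟨by simpa using hβ.1.trans (hα _ s i rfl hz), ih hz.1 β hβ.2⟩

end shrunkTree

/-- A subset of a compact metric space whose neighbourhoods have an `ω^ω`-indexed antitone base is
σ-compact (a form of Christensen's theorem for the complement). -/
theorem isSigmaCompact_of_antitone_nhdsSet_basis [MetricSpace Z] [CompactSpace Z] {F : Set Z}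
    {O : (ℕ → ℕ) → Set Z} (hanti : Antitone O) (hopen : ∀ α, IsOpen (O α)) (hF : ∀ α, F ⊆ O α)
    (hO : ∀ V, IsOpen V → F ⊆ V → ∃ α, O α ⊆ V) : IsSigmaCompact F := by
  choose C hCclosed hCsub hCG hCmono using fun s => (isOpen_goodSet F O s).exists_iUnion_isClosed
  set H := shrunkTree (goodSet F O) C with hH
  have hG := goodSet_nil hO
  have hlevel : ∀ k, ∀ z ∉ F, ∃ s : List ℕ, s.length = k ∧ z ∈ H s := by
    intro k z hz
    induction k with
    | zero => exact ⟨[], rfl, mem_univ z⟩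
    | succ k ih =>
      obtain ⟨s, hs, hzs⟩ := ih
      obtain ⟨i, hi⟩ := exists_mem_shrunkTree_cons hCsub hzs
        (exists_mem_goodSet_cons (shrunkTree_subset hG s hzs) hz)
      exact ⟨i :: s, by simp [hs], hi⟩
  have hFeq : F = (closure Fᶜ)ᶜ ∪ ⋃ k : ℕ, (⋃ s ∈ {s : List ℕ | s.length = k}, H s)ᶜ := by
    refine Subset.antisymm (fun z hz => ?_) (union_subset ?_ (iUnion_subset fun k z hz => ?_))
    -- The nodes containing `z` need not lie on one branch; point-finiteness yields a single `α`
    -- bounding them all.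
    · by_contra hcon
      obtain ⟨hcl, hlev⟩ := not_or.1 hcon
      obtain ⟨α, hα⟩ := exists_bound_of_mem_shrunkTree hCG hCmono z
      refine notMem_of_forall_mem_goodSet hanti hopen hF (α := α) (fun k => ?_)
        (not_not.1 hcl) hz
      obtain ⟨s, rfl, hs⟩ := mem_iUnion₂.1 (not_not.1 fun h => hlev (mem_iUnion.2 ⟨k, h⟩))
      exact goodSet_mono (hα s hs) (shrunkTree_subset hG s hs)
    · exact compl_subset_comm.1 subset_closure
    · by_contra hzF
      obtain ⟨s, hs, hzs⟩ := hlevel k z hzF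
      exact hz (mem_biUnion hs hzs)
  have hopenσ : IsSigmaCompact (closure Fᶜ)ᶜ := by
    obtain ⟨K, hK, -, hKU, -⟩ := (isClosed_closure (s := Fᶜ)).isOpen_compl.exists_iUnion_isClosed
    exact ⟨K, fun n => (hK n).isCompact, hKU⟩
  have hunion : IsSigmaCompact (⋃ k : ℕ, (⋃ s ∈ {s : List ℕ | s.length = k}, H s)ᶜ) :=
    isSigmaCompact_iUnion_of_isCompact _ fun k => (isOpen_biUnion fun s _ =>
      isOpen_shrunkTree (isOpen_goodSet F O) hCclosed s).isClosed_compl.isCompact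
  rw [hFeq, union_eq_iUnion]
  exact isSigmaCompact_iUnion _ (by rintro (_ | _) <;> assumption)

end Christensen

/-! ### Frontiers of closed sets with an antitone neighbourhood base -/

section Frontier

variable {X : Type*} [MetricSpace X]

/-- Given a positive radius at every point of the frontier of a closed set `A`, there is an open
neighbourhood `U` of `A` such that the frontier is covered by those balls that are not contained
in `U`. -/
theorem exists_isOpen_superset_forall_ball_not_subset {A : Set X} {r : frontier A → ℝ}
    (hr : ∀ x, 0 < r x) :
    ∃ U, IsOpen U ∧ A ⊆ U ∧
      ∀ x ∈ frontier A, ∃ x' : frontier A,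
        dist x x' < r x' ∧ ¬ Metric.ball (x' : X) (r x') ⊆ U := by
  obtain ⟨v, hvo, hFv, hvlf, hv⟩ := precise_refinement_set (isClosed_frontier (s := A))
    (fun x : frontier A => Metric.ball (x : X) (r x)) (fun _ => Metric.isOpen_ball)
    (fun x hx => mem_iUnion.2 ⟨⟨x, hx⟩, Metric.mem_ball_self (hr _)⟩)
  -- Removing one point outside `A` from each `v i` that has one leaves an open set, by local
  -- finiteness.
  have hD : ∀ i, ∃ D, IsClosed D ∧ D ⊆ v i \ A ∧ ((v i \ A).Nonempty → D.Nonempty) := by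
    intro i
    rcases (v i \ A).eq_empty_or_nonempty with h | ⟨y, hy⟩
    · exact ⟨∅, isClosed_empty, empty_subset _, fun h' => absurd h h'.ne_empty⟩
    · exact ⟨{y}, isClosed_singleton, singleton_subset_iff.2 hy, fun _ => singleton_nonempty y⟩
  choose D hDc hDv hDne using hD
  refine ⟨(⋃ i, D i)ᶜ,
    ((hvlf.subset fun i => (hDv i).trans sdiff_subset).isClosed_iUnion hDc).isOpen_compl,
    fun x hx hxD => ?_, fun x hx => ?_⟩
  · obtain ⟨i, hi⟩ := mem_iUnion.1 hxD
    exact (hDv i hi).2 hx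
  · obtain ⟨i, hi⟩ := mem_iUnion.1 (hFv hx)
    refine ⟨i, hv i hi, fun hsub => ?_⟩
    have hxc : x ∈ closure Aᶜ := by
      rw [frontier_eq_closure_inter_closure] at hx
      exact hx.2
    obtain ⟨y, hyv, hyA⟩ := mem_closure_iff.1 hxc _ (hvo i) hi
    obtain ⟨d, hd⟩ := hDne i ⟨y, hyv, hyA⟩
    exact hsub (hv i (hDv i hd).1) (mem_iUnion.2 ⟨i, hd⟩)

variable {A : Set X} {ι : Type*} {W : ι → Set X}

/-- Let `W` be a countable family of open sets such that, for every open `U ⊇ A`, each point of `A`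
lies in a member of `W` contained in `U`. Then each point of `A` lies in a finite intersection of
members of `W` that meets a given separated subset of the frontier of `A` in a finite set. -/
theorem exists_finset_inter_finite [Countable ι] (hW : ∀ i, IsOpen (W i))
    (hWA : ∀ U, IsOpen U → A ⊆ U → ∀ x ∈ A, ∃ i, x ∈ W i ∧ W i ⊆ U) {E : Set X}
    (hE : E ⊆ frontier A) {ε : ℝ} (hε : 0 < ε) (hsep : E.Pairwise fun x y => ε ≤ dist x y)
    {x : X} (hx : x ∈ A) :
    ∃ t : Finset ι, x ∈ ⋂ i ∈ t, W i ∧ (E ∩ ⋂ i ∈ t, W i).Finite := by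
  classical
  obtain ⟨enc, henc⟩ := exists_injective_nat ι
  by_contra! hinf
  have hfin : ∀ m : ℕ, {i | x ∈ W i ∧ enc i ≤ m}.Finite := fun m =>
    ((finite_Iic m).preimage henc.injOn).subset fun i hi => hi.2
  have hP : ∀ m : ℕ, (E ∩ ⋂ i ∈ (hfin m).toFinset, W i).Infinite := fun m =>
    hinf _ (mem_iInter₂.2 fun i hi => ((hfin m).mem_toFinset.1 hi).1)
  obtain ⟨f, hf, hfr⟩ := exists_seq_of_forall_finset_exists
    (fun p : ℕ × X => p.2 ∈ E ∩ ⋂ i ∈ (hfin p.1).toFinset, W i)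
    (fun p q => p.1 < q.1 ∧ p.2 ≠ q.2) (by
      intro s _
      obtain ⟨y, hy, hys⟩ := (hP (s.sup Prod.fst + 1)).exists_notMem_finset (s.image Prod.snd)
      refine ⟨(s.sup Prod.fst + 1, y), hy, fun p hp => ⟨?_, fun h => hys ?_⟩⟩
      · exact Nat.lt_succ_of_le (Finset.le_sup (f := Prod.fst) hp)
      · exact Finset.mem_image.2 ⟨p, hp, h⟩)
  have hmono : StrictMono fun n => (f n).1 := fun m n h => (hfr m n h).1
  have hinj : ∀ m n, m ≠ n → (f m).2 ≠ (f n).2 := fun m n h => by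
    rcases h.lt_or_gt with h | h
    · exact (hfr m n h).2
    · exact (hfr n m h).2.symm
  -- Points moved off `A` by less than `ε / 3` stay `ε / 3`-separated, so they form a closed set
  -- disjoint from `A`.
  have hy : ∀ n, ∃ y ∈ ⋂ i ∈ (hfin (f n).1).toFinset, W i, y ∉ A ∧ dist (f n).2 y < ε / 3 := by
    intro n
    have hc : (f n).2 ∈ closure Aᶜ := by
      have := hE (hf n).1
      rw [frontier_eq_closure_inter_closure] at this
      exact this.2
    obtain ⟨y, ⟨hyW, hyb⟩, hyA⟩ := mem_closure_iff.1 hc _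
      ((isOpen_biInter_finset fun i _ => hW i).inter
        (Metric.isOpen_ball (x := (f n).2) (ε := ε / 3)))
      ⟨(hf n).2, Metric.mem_ball_self (by positivity)⟩
    exact ⟨y, hyW, hyA, by rw [dist_comm]; exact hyb⟩
  choose y hyW hyA hyd using hy
  have hclosed : IsClosed (range y) := by
    refine Metric.isClosed_of_pairwise_le_dist (ε := ε / 3) (by positivity) ?_
    rintro _ ⟨m, rfl⟩ _ ⟨n, rfl⟩ hmn
    have h1 := hsep (hf m).1 (hf n).1 (hinj m n fun h => hmn (h ▸ rfl))
    have h2 := dist_triangle4 (f m).2 (y m) (y n) (f n).2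
    have h3 := hyd m
    have h4 := hyd n
    rw [dist_comm (y n)] at h2
    linarith
  obtain ⟨i, hxi, hi⟩ := hWA (range y)ᶜ hclosed.isOpen_compl
    (fun a ha ⟨n, hn⟩ => hyA n (hn ▸ ha)) x hx
  refine hi (mem_iInter₂.1 (hyW (enc i)) i ?_) ⟨enc i, rfl⟩
  exact (hfin _).mem_toFinset.2 ⟨hxi, hmono.le_apply⟩

theorem countable_of_separated_subset_frontier [Countable ι] (hA : IsClosed A)
    (hW : ∀ i, IsOpen (W i))
    (hWA : ∀ U, IsOpen U → A ⊆ U → ∀ x ∈ A, ∃ i, x ∈ W i ∧ W i ⊆ U) {E : Set X}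
    (hE : E ⊆ frontier A) {ε : ℝ} (hε : 0 < ε) (hsep : E.Pairwise fun x y => ε ≤ dist x y) :
    E.Countable := by
  have hcount : (⋃ t : {t : Finset ι // (E ∩ ⋂ i ∈ t, W i).Finite},
      E ∩ ⋂ i ∈ t.1, W i).Countable :=
    countable_iUnion fun t => t.2.countable
  refine hcount.mono fun x hx => ?_
  obtain ⟨t, hxt, ht⟩ :=
    exists_finset_inter_finite hW hWA hE hε hsep (hA.frontier_subset (hE hx))
  exact mem_iUnion.2 ⟨⟨t, ht⟩, hx, hxt⟩

theorem secondCountableTopology_frontier [Countable ι] (hA : IsClosed A)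
    (hW : ∀ i, IsOpen (W i))
    (hWA : ∀ U, IsOpen U → A ⊆ U → ∀ x ∈ A, ∃ i, x ∈ W i ∧ W i ⊆ U) :
    SecondCountableTopology (frontier A) := by
  refine Metric.secondCountable_of_almost_dense_set fun ε hε => ?_
  obtain ⟨N, hN⟩ := zorn_subset {N : Set (frontier A) | N.Pairwise fun x y => ε ≤ dist x y}
    fun c hc hchain => ⟨⋃₀ c, (pairwise_sUnion hchain.directedOn).2 hc,
      fun s hs => subset_sUnion_of_mem hs⟩
  refine ⟨N, ?_, fun x => ?_⟩
  · refine countable_of_injective_of_countable_image Subtype.val_injective.injOn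
      (countable_of_separated_subset_frontier hA hW hWA (E := Subtype.val '' N) ?_ hε ?_)
    · rintro _ ⟨x, -, rfl⟩
      exact x.2
    · rintro _ ⟨x, hx, rfl⟩ _ ⟨y, hy, rfl⟩ hxy
      exact hN.prop hx hy fun h => hxy (h ▸ rfl)
  · by_contra! hx
    have hins : insert x N ∈ {N : Set (frontier A) | N.Pairwise fun x y => ε ≤ dist x y} :=
      pairwise_insert.2 ⟨hN.prop, fun y hy _ => ⟨(hx y hy).le, dist_comm x y ▸ (hx y hy).le⟩⟩
    have hxN : x ∈ N := hN.le_of_ge hins (subset_insert x N) (mem_insert x N)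
    exact absurd (hx x hxN) (by simpa using hε.le)

/-- If the neighbourhoods of a closed subset of a metric space have an `ω^ω`-indexed antitone
base, then the frontier of this set is σ-compact. -/
theorem isSigmaCompact_frontier_of_antitone_nhdsSet_basis (hA : IsClosed A)
    {U : (ℕ → ℕ) → Set X} (hanti : Antitone U) (hopen : ∀ α, IsOpen (U α)) (hAU : ∀ α, A ⊆ U α)
    (hU : ∀ V, IsOpen V → A ⊆ V → ∃ α, U α ⊆ V) : IsSigmaCompact (frontier A) := by
  have hsc : SecondCountableTopology (frontier A) := by
    refine secondCountableTopology_frontier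
      (W := fun s : List ℕ => interior (⋂ β ∈ {β | IsPrefixBound s β}, U β)) hA
      (fun _ => isOpen_interior) fun V hV hAV x hx => ?_
    obtain ⟨α, hα⟩ := hU V hV hAV
    obtain ⟨k, N, hN, hNU⟩ := exists_nhds_subset_of_isPrefixBound hanti
      (fun α => (hopen α).mem_nhds (hAU α hx)) α
    refine ⟨revPrefix α k, mem_interior_iff_mem_nhds.2
      (Filter.mem_of_superset hN (subset_iInter₂ hNU)), ?_⟩
    exact interior_subset.trans ((biInter_subset_of_mem
      (show α ∈ {β | IsPrefixBound (revPrefix α k) β} from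
        isPrefixBound_revPrefix.2 fun _ _ => le_rfl)).trans hα)
  obtain ⟨e, he⟩ := Metric.PiNatEmbed.exists_embedding_to_hilbert_cube (X := frontier A)
  let _ := TopologicalSpace.metrizableSpaceMetric (ℕ → unitInterval)
  rw [isSigmaCompact_iff_isSigmaCompact_univ, he.isSigmaCompact_iff, image_univ]
  -- The same radius is used in `X` and in the cube, which makes `O` antitone.
  let O : (ℕ → ℕ) → Set (ℕ → unitInterval) := fun α =>
    ⋃ (x : frontier A) (r : ℝ) (_ : 0 < r ∧ Metric.ball (x : X) r ⊆ U α), Metric.ball (e x) r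
  refine isSigmaCompact_of_antitone_nhdsSet_basis (O := O) ?_ ?_ ?_ ?_
  · intro α β hαβ
    exact iUnion_mono fun x => iUnion_mono fun r =>
      iUnion_mono' fun h => ⟨⟨h.1, h.2.trans (hanti hαβ)⟩, le_rfl⟩
  · exact fun α => isOpen_iUnion fun _ => isOpen_iUnion fun _ => isOpen_iUnion fun _ =>
      Metric.isOpen_ball
  · rintro α _ ⟨x, rfl⟩
    obtain ⟨r, hr, hrU⟩ :=
      Metric.isOpen_iff.1 (hopen α) x (hAU α (hA.frontier_subset x.2))
    simp only [O, mem_iUnion]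
    exact ⟨x, r, ⟨hr, hrU⟩, Metric.mem_ball_self hr⟩
  · intro V hV heV
    have hρ : ∀ x : frontier A, ∃ ρ r : ℝ, 0 < r ∧ 4 * r ≤ ρ ∧ Metric.ball (e x) ρ ⊆ V ∧
        ∀ y : frontier A, dist y x < r → dist (e y) (e x) < ρ / 2 := by
      intro x
      obtain ⟨ρ, hρ, hρV⟩ := Metric.isOpen_iff.1 hV _ (heV ⟨x, rfl⟩)
      obtain ⟨δ, hδ, hδe⟩ := Metric.continuous_iff.1 he.continuous x (ρ / 2) (half_pos hρ)
      refine ⟨ρ, min δ (ρ / 4), by positivity, ?_, hρV,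
        fun y hy => hδe y (hy.trans_le (min_le_left _ _))⟩
      have := min_le_right δ (ρ / 4)
      linarith
    choose ρ r hr hrρ hρV hre using hρ
    obtain ⟨G, hG, hAG, hGr⟩ := exists_isOpen_superset_forall_ball_not_subset hr
    obtain ⟨α, hα⟩ := hU G hG hAG
    refine ⟨α, iUnion_subset fun x => iUnion_subset fun s => iUnion_subset fun hs z hz => ?_⟩
    obtain ⟨x', hxx', hx'⟩ := hGr x x.2
    -- If `s > ρ x' / 2 ≥ 2 * r x'`, the ball about `x` would swallow the ball about `x'`, which
    -- leaves `G`.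
    have hs' : s ≤ ρ x' / 2 := by
      by_contra! hlt
      refine hx' ((Metric.ball_subset_ball' ?_).trans (hs.2.trans hα))
      rw [dist_comm]
      linarith [hrρ x']
    refine hρV x' (Metric.mem_ball.2 ?_)
    linarith [dist_triangle z (e x) (e x'), Metric.mem_ball.1 hz, hre x' x hxx']

end Frontier

/-! ### From the hyperspace to neighbourhoods of a closed set -/

theorem CL.upper_mem_nhds {X : Type*} [TopologicalSpace X] {U : Set X} (hU : IsOpen U) {A : CL X}
    (hA : A.1 ⊆ U) : CL.upper U ∈ @nhds _ (locallyFiniteTopology X) A :=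
  let _ := locallyFiniteTopology X
  IsOpen.mem_nhds (TopologicalSpace.isOpen_generateFrom_of_mem (Or.inl ⟨U, hU, rfl⟩)) hA

/-- If a basic set `U⁺ ∩ 𝒱⁻` containing `A` is contained in `W⁺`, then `U ⊆ W`. -/
theorem CL.subset_of_upper_inter_lower_subset {X : Type*} [TopologicalSpace X] [T1Space X]
    {U W : Set X} {𝒱 : Set (Set X)} {A : CL X} (hA : A ∈ CL.upper U ∩ CL.lower 𝒱)
    (h : CL.upper U ∩ CL.lower 𝒱 ⊆ CL.upper W) : U ⊆ W := by
  intro x hx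
  let B : CL X := ⟨insert x A.1, insert_nonempty _ _, by
    rw [insert_eq]
    exact isClosed_singleton.union A.2.2⟩
  have hB : B ∈ CL.upper W :=
    h ⟨insert_subset hx hA.1, fun V hV => (hA.2 V hV).mono
      (inter_subset_inter_left V (subset_insert x A.1))⟩
  exact hB (mem_insert x A.1)

theorem theorem3p10 {X : Type*} [TopologicalSpace X] [TopologicalSpace.MetrizableSpace X]
    (h : HasOmegaOmegaBaseOf (locallyFiniteTopology X) IsLocallyFiniteBasic)
    (A : Set X) (hA : IsClosed A) :
    IsSigmaCompact (frontier A) := by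
  let _ := TopologicalSpace.metrizableSpaceMetric X
  rcases A.eq_empty_or_nonempty with rfl | hne
  · simp
  obtain ⟨B, hB, hanti, hbasic⟩ := h ⟨A, hne, hA⟩
  choose U 𝒱 hU _ hBU using hbasic
  have hmem : ∀ α, (⟨A, hne, hA⟩ : CL X) ∈ CL.upper (U α) ∩ CL.lower (𝒱 α) := fun α =>
    (hBU α).subset (@mem_of_mem_nhds _ (locallyFiniteTopology X) _ _ (hB.mem_of_mem trivial))
  refine isSigmaCompact_frontier_of_antitone_nhdsSet_basis hA (U := U) (fun α β hαβ => ?_) hU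
    (fun α => (hmem α).1) (fun V hV hAV => ?_)
  · refine CL.subset_of_upper_inter_lower_subset (hmem β) ?_
    rw [← hBU β]
    exact (hanti α β hαβ).trans ((hBU α).subset.trans inter_subset_left)
  · obtain ⟨α, -, hα⟩ := hB.mem_iff.1
      (CL.upper_mem_nhds (A := ⟨A, hne, hA⟩) hV hAV)
    exact ⟨α, CL.subset_of_upper_inter_lower_subset (hmem α) (hBU α ▸ hα)⟩
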